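/- Let $\sigma=\mathrm{Prop}\cup\{R_i: i\in I\}$ be a modal signature with a finite set $\mathrm{Prop}$ of proposition letters (unary predicates) and finitely many actions (binary predicates) $R_i$. A $\sigma$-LTS $M_a$ is a $\sigma$-structure $M$ with one distinguished element $a$; it is finite if $\mathrm{dom}(M)$ is finite. Formulas of $\mathrm{ML}_{\#}^{G}$ are given by $$\varphi ::= \top \mid p \mid \varphi\wedge\varphi \mid \varphi\vee\varphi \mid \neg\varphi \mid \Diamond_i\varphi \mid \Box_i\varphi \mid \Diamond_i^{\ge k}\varphi\ (k\ge 1) \mid \mathrm{E}^{\ge k}\varphi\ (k\ge 0),$$ with $p\in\mathrm{Prop}$ and $i\in I$, and the usual semantics of the Boolean connectives and of $\Diamond_i,\Box_i$; moreover $M_a\models\Diamond_i^{\ge k}\varphi$ iff at least $k$ elements $b$ with $R_i^M(a,b)$ satisfy $M_b\models\varphi$, and $M_a\models\mathrm{E}^{\ge k}\varphi$ iff at least $k$ elements $b\in\mathrm{dom}(M)$ satisfy $M_b\models\varphi$. Write $M_a\equiv^{\sigma}_{\mathrm{ML}_{\#}^{G}}N_b$ if $M_a$ and $N_b$ satisfy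 the same formulas of $\mathrm{ML}_{\#}^{G}$. A directed path from $m$ to $n$ is a (possibly empty, if $m=n$) sequence of binary facts $R_{i_1}(b_0,b_1),R_{i_2}(b_1,b_2),\dots,R_{i_k}(b_{k-1},b_k)$ with $b_0=m$, $b_k=n$; two paths are equal if they consist of the same facts (including the actions) in the same order. A $\sigma$-LTS $M_a$ is a $\sigma$-tree if for every $m\in\mathrm{dom}(M)$ there is exactly one directed path from $a$ to $m$. A $\sigma$-forest is (up to isomorphism) a disjoint union of a finite family of $\sigma$-trees, with the root of one of them as distinguished element. Let $\mathcal F_\sigma$ be the class of finite $\sigma$-forests. Homomorphisms preserve all facts and the distinguished element, and $\hom_{\mathbb N}(T_c,M_a)$ is the number of homomorphisms from $T_c$ to $M_a$. **Theorem.** Let $M_a$ and $N_b$ be finite $\sigma$-LTSs. Then $$M_a\equiv^{\sigma}_{\mathrm{ML}_{\#}^{G}}N_b \quad\Longleftrightarrow\quad \hom_{\mathbb N}(T_c,M_a)=\hom_{\mathbb N}(T_c,N_b)\ \text{ for every } T_c\in\mathcal F_\sigma .$$ -/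

import Mathlib

universe u v w w₁ w₂ t

namespace ModalHom

/-- A labeled transition system (with one distinguished state `pt`) over the modal signature
whose proposition letters are the elements of `P` and whose actions are `R i`, for `i : I`. -/
structure LTS (P : Type u) (I : Type v) where
  /-- the set of states -/
  carrier : Type w
  /-- the interpretation of the proposition letters -/
  prop : P → carrier → Prop
  /-- the interpretation of the actions -/
  rel : I → carrier → carrier → Prop
  /-- the distinguished state -/
  pt : carrier

variable {P : Type u} {I : Type v}

namespace LTS

/-- `f` maps the distinguished state to the distinguished state and preserves all facts. -/
structure IsHom (M : LTS.{u, v, w₁} P I) (N : LTS.{u, v, w₂} P I)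
    (f : M.carrier → N.carrier) : Prop where
  map_pt : f M.pt = N.pt
  map_prop : ∀ p x, M.prop p x → N.prop p (f x)
  map_rel : ∀ i x y, M.rel i x y → N.rel i (f x) (f y)

/-- The collection of homomorphisms from `M` to `N`. -/
def Hom (M : LTS.{u, v, w₁} P I) (N : LTS.{u, v, w₂} P I) : Type (max w₁ w₂) :=
  {f : M.carrier → N.carrier // M.IsHom N f}

/-- `M` and `N` are isomorphic: some bijective homomorphism has a homomorphism as inverse. -/
def IsIso (M : LTS.{u, v, w₁} P I) (N : LTS.{u, v, w₂} P I) : Prop :=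
  ∃ e : M.carrier ≃ N.carrier, M.IsHom N e ∧ N.IsHom M e.symm

/-- Between finite systems there are finitely many homomorphisms, so they can be counted. -/
instance (M : LTS.{u, v, w₁} P I) (N : LTS.{u, v, w₂} P I) [Finite M.carrier]
    [Finite N.carrier] : Finite (M.Hom N) :=
  inferInstanceAs (Finite {f : M.carrier → N.carrier // M.IsHom N f})

/-- The homomorphism count over the semiring `S`: the sum of as many copies of `1 : S` as there
are homomorphisms from `M` to `N` (meaningful when there are finitely many of these). -/
noncomputable def homCount (S : Type*) [Semiring S] (M : LTS.{u, v, w₁} P I)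
    (N : LTS.{u, v, w₂} P I) : S :=
  ((Nat.card (M.Hom N) : ℕ) : S)

/-- The left homomorphism vector of `M` over `S` restricted to the class `C`. -/
noncomputable def leftProfile (S : Type*) [Semiring S] (C : Set (LTS.{u, v, t} P I))
    (M : LTS.{u, v, w} P I) : C → S :=
  fun T => homCount S T.1 M

/-- The binary facts of `M`: an arrow from `x` to `y` is an action that holds of `(x, y)`.
A directed path is then a `Quiver.Path`, that is, a (possibly empty) sequence of composable
binary facts. -/
instance quiver (M : LTS.{u, v, w} P I) : Quiver M.carrier where
  Hom x y := {i : I // M.rel i x y}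

/-- `M` is a tree: there is a unique directed path from the distinguished state to each state. -/
def IsTree (M : LTS.{u, v, w} P I) : Prop :=
  ∀ m : M.carrier, Nonempty (Unique (Quiver.Path M.pt m))

/-- The disjoint union of a family of systems, with the distinguished state of the `j₀`-th. -/
def disjointUnion {J : Type} (F : J → LTS.{u, v, w} P I) (j₀ : J) : LTS.{u, v, w} P I where
  carrier := Σ j, (F j).carrier
  prop p x := (F x.1).prop p x.2
  rel i x y := ∃ (j : J) (a b : (F j).carrier), x = ⟨j, a⟩ ∧ y = ⟨j, b⟩ ∧ (F j).rel i a b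
  pt := ⟨j₀, (F j₀).pt⟩

/-- `M` is a forest: up to isomorphism, it is a disjoint union of finitely many trees, whose
distinguished state is the root of one of them. -/
def IsForest (M : LTS.{u, v, w} P I) : Prop :=
  ∃ (J : Type) (_ : Finite J) (F : J → LTS.{u, v, w} P I) (j₀ : J),
    (∀ j, (F j).IsTree) ∧ M.IsIso (disjointUnion F j₀)

end LTS

/-- The class of finite forests. -/
def finiteForests (P : Type u) (I : Type v) : Set (LTS.{u, v, t} P I) :=
  {T | Finite T.carrier ∧ T.IsForest}

/-- Formulas of graded modal logic with the counting global modalities. -/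
inductive Formula (P : Type u) (I : Type v) : Type (max u v)
  | top : Formula P I
  | letter (p : P) : Formula P I
  | and (φ ψ : Formula P I) : Formula P I
  | or (φ ψ : Formula P I) : Formula P I
  | neg (φ : Formula P I) : Formula P I
  | dia (i : I) (φ : Formula P I) : Formula P I
  | box (i : I) (φ : Formula P I) : Formula P I
  /-- at least `k` many `R i`-successors satisfy `φ` -/
  | gradedDia (i : I) (k : ℕ+) (φ : Formula P I) : Formula P I
  /-- at least `k` many states satisfy `φ` -/
  | global (k : ℕ) (φ : Formula P I) : Formula P I

/-- Truth of a formula at the state `x` of `M` (the distinguished state of `M` plays no role). -/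
def Sat (M : LTS.{u, v, w} P I) : M.carrier → Formula P I → Prop
  | _, .top => True
  | x, .letter p => M.prop p x
  | x, .and φ ψ => Sat M x φ ∧ Sat M x ψ
  | x, .or φ ψ => Sat M x φ ∨ Sat M x ψ
  | x, .neg φ => ¬ Sat M x φ
  | x, .dia i φ => ∃ y, M.rel i x y ∧ Sat M y φ
  | x, .box i φ => ∀ y, M.rel i x y → Sat M y φ
  | x, .gradedDia i k φ => ((k : ℕ) : ℕ∞) ≤ {y | M.rel i x y ∧ Sat M y φ}.encard
  | _, .global k φ => (k : ℕ∞) ≤ {y | Sat M y φ}.encard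

/-- `M` and `N` satisfy the same formulas at their distinguished states. -/
def Equivalent (M : LTS.{u, v, w₁} P I) (N : LTS.{u, v, w₂} P I) : Prop :=
  ∀ φ : Formula P I, Sat M M.pt φ ↔ Sat N N.pt φ

end ModalHom

/-!
Both equivalences characterise counting bisimilarity, the existence of a relation that matches the
successors of related states, and the states of the two systems altogether, by bijections. Such a
relation clearly preserves the truth of formulas and the number of homomorphisms from a tree that
send the root to a given state. Conversely, attach to each state the vector of the truth values of
all formulas, or that of the homomorphism counts of all trees. Both collections of vectors are
closed under products of coordinates: conjunction multiplies truth values, and gluing trees at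
their roots multiplies homomorphism counts. Hence each of the two equivalences provides all moments
of the vectors attached to the states, or to the successors of a state, and since distinct
characters of a monoid are linearly independent, these moments determine the vectors up to a
bijection.
-/

namespace ModalHom

variable {P : Type u} {I : Type v}

/-! ### Families of vectors with equal moments -/

theorem exists_equiv_of_sum_eq_sum_of_linearIndependent {R V ι A B : Type*} [Semiring R]
    [CharZero R] [AddCommMonoid V] [Module R V] [Fintype A] [Fintype B] {v : ι → V}
    (hv : LinearIndependent R v) {f : A → ι} {g : B → ι}
    (h : ∑ a, v (f a) = ∑ b, v (g b)) : ∃ e : A ≃ B, ∀ a, g (e a) = f a := by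
  classical
  have hsingle : ∑ a, Finsupp.single (f a) (1 : R) = ∑ b, Finsupp.single (g b) 1 :=
    hv (by simpa only [map_sum, Finsupp.linearCombination_single, one_smul] using h)
  have hfiber (c : ι) : Fintype.card {a // f a = c} = Fintype.card {b // g b = c} := by
    simpa [Finsupp.finsetSum_apply, Finsupp.single_apply, Fintype.card_subtype]
      using DFunLike.congr_fun hsingle c
  exact ⟨Equiv.ofFiberEquiv fun c => Fintype.equivOfCardEq (hfiber c), Equiv.ofFiberEquiv_map _⟩

/-- The vectors `f a` and `g b` extend to characters of the free monoid on `K`, and distinct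
characters are linearly independent. -/
theorem exists_equiv_of_sum_list_prod_eq {R K A B : Type*} [CommRing R] [IsDomain R] [CharZero R]
    [Fintype A] [Fintype B] {f : A → K → R} {g : B → K → R}
    (h : ∀ l : List K, ∑ a, (l.map (f a)).prod = ∑ b, (l.map (g b)).prod) :
    ∃ e : A ≃ B, ∀ a, g (e a) = f a := by
  have hcharacters : LinearIndependent R fun r : K → R => (FreeMonoid.lift r : FreeMonoid K → R) :=
    (linearIndependent_monoidHom (FreeMonoid K) R).comp _ FreeMonoid.lift.injective
  refine exists_equiv_of_sum_eq_sum_of_linearIndependent hcharacters (funext fun l => ?_)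
  simpa only [Finset.sum_apply, FreeMonoid.lift_apply] using h l.toList

theorem exists_equiv_of_sum_list_prod_eq_nat {K A B : Type*} [Fintype A] [Fintype B]
    {f : A → K → ℕ} {g : B → K → ℕ}
    (h : ∀ l : List K, ∑ a, (l.map (f a)).prod = ∑ b, (l.map (g b)).prod) :
    ∃ e : A ≃ B, ∀ a, g (e a) = f a := by
  have hcast (l : List K) : ∑ a, (l.map fun k => (f a k : ℤ)).prod =
      ∑ b, (l.map fun k => (g b k : ℤ)).prod := by
    simpa [Nat.cast_list_prod, Function.comp_def] using congrArg (Nat.cast : ℕ → ℤ) (h l)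
  obtain ⟨e, he⟩ := exists_equiv_of_sum_list_prod_eq hcast
  exact ⟨e, fun a => funext fun k => Nat.cast_injective (congrFun (he a) k)⟩

theorem encard_setOf_subtype {X : Type*} (p q : X → Prop) :
    {x : Subtype p | q x}.encard = {x | p x ∧ q x}.encard :=
  Set.encard_congr (Equiv.subtypeSubtypeEquivSubtypeInter p q)

open Classical in
theorem cast_sum_ite_eq_encard {X : Type*} [Fintype X] (p : X → Prop) :
    ((∑ x, if p x then 1 else 0 : ℕ) : ℕ∞) = {x | p x}.encard := by
  rw [Finset.sum_boole, Nat.cast_id, ← Set.encard_coe_eq_coe_finsetCard, Finset.coe_filter_univ]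

theorem ite_one_zero_inj {p q : Prop} [Decidable p] [Decidable q] :
    ((if p then 1 else 0 : ℕ) = if q then 1 else 0) ↔ (p ↔ q) := by
  split_ifs <;> simp [*]

/-! ### Counting bisimulations and formulas -/

/-- `Z` is a graded bisimulation between `M` and `N` with a global clause: related states satisfy
the same letters, their successors can be matched bijectively within `Z`, and so can all states
of `M` and `N`. The distinguished states need not be related. -/
structure IsCountingBisimulation (M : LTS.{u, v, w₁} P I) (N : LTS.{u, v, w₂} P I)
    (Z : M.carrier → N.carrier → Prop) : Prop where
  prop_iff : ∀ {x y}, Z x y → ∀ p, M.prop p x ↔ N.prop p y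
  exists_equiv_succ : ∀ {x y}, Z x y → ∀ i,
    ∃ e : {x' // M.rel i x x'} ≃ {y' // N.rel i y y'}, ∀ x', Z x'.1 (e x').1
  exists_equiv : ∃ e : M.carrier ≃ N.carrier, ∀ x, Z x (e x)

/-- Some counting bisimulation relates the distinguished states of `M` and `N`. -/
def CountingBisimilar (M : LTS.{u, v, w₁} P I) (N : LTS.{u, v, w₂} P I) : Prop :=
  ∃ Z, IsCountingBisimulation M N Z ∧ Z M.pt N.pt

section Formulas

variable {M : LTS.{u, v, w₁} P I} {N : LTS.{u, v, w₂} P I}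

theorem IsCountingBisimulation.sat_iff {Z : M.carrier → N.carrier → Prop}
    (hZ : IsCountingBisimulation M N Z) (φ : Formula P I) {x : M.carrier} {y : N.carrier}
    (hxy : Z x y) : Sat M x φ ↔ Sat N y φ := by
  induction φ generalizing x y with
  | top => rfl
  | letter p => exact hZ.prop_iff hxy p
  | and φ ψ ihφ ihψ => exact and_congr (ihφ hxy) (ihψ hxy)
  | or φ ψ ihφ ihψ => exact or_congr (ihφ hxy) (ihψ hxy)
  | neg φ ih => exact not_congr (ih hxy)
  | dia i φ ih =>
    obtain ⟨e, he⟩ := hZ.exists_equiv_succ hxy i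
    have hexists : (∃ x' : {x' // M.rel i x x'}, Sat M x' φ) ↔
        ∃ y' : {y' // N.rel i y y'}, Sat N y' φ := e.exists_congr fun x' => ih (he x')
    simpa only [Sat, Subtype.exists, exists_prop] using hexists
  | box i φ ih =>
    obtain ⟨e, he⟩ := hZ.exists_equiv_succ hxy i
    have hforall : (∀ x' : {x' // M.rel i x x'}, Sat M x' φ) ↔
        ∀ y' : {y' // N.rel i y y'}, Sat N y' φ := e.forall_congr fun x' => ih (he x')
    simpa only [Sat, Subtype.forall] using hforall
  | gradedDia i k φ ih =>
    obtain ⟨e, he⟩ := hZ.exists_equiv_succ hxy i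
    have hcard : {x' : {x' // M.rel i x x'} | Sat M x' φ}.encard =
        {y' : {y' // N.rel i y y'} | Sat N y' φ}.encard :=
      Set.encard_congr (e.subtypeEquiv fun x' => ih (he x'))
    simp only [Sat, ← encard_setOf_subtype, hcard]
  | global k φ ih =>
    obtain ⟨e, he⟩ := hZ.exists_equiv
    have hcard : {x' | Sat M x' φ}.encard = {y' | Sat N y' φ}.encard :=
      Set.encard_congr (e.subtypeEquiv fun x' => ih (he x'))
    simp only [Sat, hcard]

theorem CountingBisimilar.equivalent (h : CountingBisimilar M N) : Equivalent M N := by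
  obtain ⟨Z, hZ, hpt⟩ := h
  exact fun φ => hZ.sat_iff φ hpt

open Classical in
theorem prod_map_ite_sat (x : M.carrier) (l : List (Formula P I)) :
    (l.map fun φ => if Sat M x φ then 1 else 0).prod =
      if Sat M x (l.foldr .and .top) then 1 else 0 := by
  induction l with
  | nil => simp [Sat]
  | cons φ l ih =>
    simp only [List.map_cons, List.prod_cons, ih, List.foldr_cons, Sat, ite_zero_mul_ite_zero,
      one_mul]

theorem exists_equiv_sat_iff {A B : Type*} [Finite A] [Finite B] {a : A → M.carrier}
    {b : B → N.carrier}
    (h : ∀ φ, {k | Sat M (a k) φ}.encard = {k | Sat N (b k) φ}.encard) :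
    ∃ e : A ≃ B, ∀ k φ, Sat M (a k) φ ↔ Sat N (b (e k)) φ := by
  classical
  have := Fintype.ofFinite A
  have := Fintype.ofFinite B
  obtain ⟨e, he⟩ := exists_equiv_of_sum_list_prod_eq_nat
    (f := fun k φ => if Sat M (a k) φ then 1 else 0)
    (g := fun k φ => if Sat N (b k) φ then 1 else 0) fun l => by
      simp only [prod_map_ite_sat]
      rw [← Nat.cast_inj (R := ℕ∞), cast_sum_ite_eq_encard, cast_sum_ite_eq_encard, h]
  exact ⟨e, fun k φ => (ite_one_zero_inj.1 (congrFun (he k) φ)).symm⟩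

theorem Equivalent.countingBisimilar [Finite M.carrier] [Finite N.carrier]
    (h : Equivalent M N) : CountingBisimilar M N := by
  refine ⟨fun x y => ∀ φ, Sat M x φ ↔ Sat N y φ, ⟨fun hxy p => hxy (.letter p), ?_, ?_⟩, h⟩
  · intro x y hxy i
    refine exists_equiv_sat_iff fun φ => ?_
    rw [encard_setOf_subtype (M.rel i x) (Sat M · φ), encard_setOf_subtype (N.rel i y) (Sat N · φ)]
    refine ENat.eq_of_forall_natCast_le_iff fun k => ?_
    rcases Nat.eq_zero_or_pos k with rfl | hk
    · simp
    · exact hxy (.gradedDia i ⟨k, hk⟩ φ)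
  · exact exists_equiv_sat_iff (a := id) (b := id) fun φ =>
      ENat.eq_of_forall_natCast_le_iff fun k => h (.global k φ)

theorem equivalent_iff_countingBisimilar [Finite M.carrier] [Finite N.carrier] :
    Equivalent M N ↔ CountingBisimilar M N :=
  ⟨Equivalent.countingBisimilar, CountingBisimilar.equivalent⟩

end Formulas

/-! ### Trees -/

namespace LTS

/-- The system `M` with the distinguished state moved to `x`. -/
abbrev withPt (M : LTS.{u, v, w} P I) (x : M.carrier) : LTS.{u, v, w} P I :=
  { M with pt := x }

section Homs

variable {L : LTS.{u, v, w₁} P I} {M : LTS.{u, v, w₂} P I} {N : LTS.{u, v, w} P I}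

theorem IsHom.comp {g : M.carrier → N.carrier} {f : L.carrier → M.carrier} (hg : M.IsHom N g)
    (hf : L.IsHom M f) : L.IsHom N (g ∘ f) where
  map_pt := (congrArg g hf.map_pt).trans hg.map_pt
  map_prop p x hx := hg.map_prop p _ (hf.map_prop p x hx)
  map_rel i x y hxy := hg.map_rel i _ _ (hf.map_rel i x y hxy)

theorem isIso_of_iff (e : L.carrier ≃ M.carrier) (map_pt : e L.pt = M.pt)
    (map_prop : ∀ p x, L.prop p x ↔ M.prop p (e x))
    (map_rel : ∀ i x y, L.rel i x y ↔ M.rel i (e x) (e y)) : L.IsIso M :=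
  ⟨e, ⟨map_pt, fun p x => (map_prop p x).1, fun i x y => (map_rel i x y).1⟩,
    ⟨e.symm_apply_eq.2 map_pt.symm, fun p x hx => by simpa [map_prop] using hx,
      fun i x y hxy => by simpa [map_rel] using hxy⟩⟩

theorem IsIso.refl (M : LTS.{u, v, w} P I) : M.IsIso M :=
  isIso_of_iff (Equiv.refl _) rfl (fun _ _ => Iff.rfl) fun _ _ _ => Iff.rfl

theorem IsIso.symm : L.IsIso M → M.IsIso L
  | ⟨e, he, he'⟩ => ⟨e.symm, he', he⟩

theorem IsIso.trans : L.IsIso M → M.IsIso N → L.IsIso N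
  | ⟨e, he, he'⟩, ⟨e₁, he₁, he₁'⟩ => ⟨e.trans e₁, he₁.comp he, he'.comp he₁'⟩

theorem IsIso.finite [Finite L.carrier] (h : L.IsIso M) : Finite M.carrier :=
  .of_equiv L.carrier h.choose

theorem IsIso.card_hom_eq (h : L.IsIso M) (N : LTS.{u, v, w} P I) :
    Nat.card (L.Hom N) = Nat.card (M.Hom N) := by
  obtain ⟨e, he, he'⟩ := h
  exact Nat.card_congr
    { toFun f := ⟨f.1 ∘ e.symm, f.2.comp he'⟩
      invFun f := ⟨f.1 ∘ e, f.2.comp he⟩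
      left_inv f := Subtype.ext (by simp [Function.comp_assoc])
      right_inv f := Subtype.ext (by simp [Function.comp_assoc]) }

theorem sigma_hom_withPt_ext {M : LTS.{u, v, w} P I} {q : M.carrier → Prop}
    {f g : Σ y : {y // q y}, L.Hom (M.withPt y)} (h : f.2.1 = g.2.1) : f = g := by
  obtain ⟨⟨y, hy⟩, f, hf⟩ := f
  obtain ⟨⟨z, hz⟩, g, hg⟩ := g
  obtain rfl : f = g := h
  obtain rfl : y = z := hf.map_pt.symm.trans hg.map_pt
  rfl

end Homs

/-- There is a directed path from `x` to `y` in `T`. -/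
def Reaches (T : LTS.{u, v, w} P I) : T.carrier → T.carrier → Prop :=
  Relation.ReflTransGen fun x y => ∃ i, T.rel i x y

/-- The local form of being a tree: every state is reachable from the distinguished one, which
has no incoming fact, and no state has two different incoming facts. -/
structure IsArborescent (T : LTS.{u, v, w} P I) : Prop where
  reaches : ∀ x, T.Reaches T.pt x
  not_rel_pt : ∀ i x, ¬ T.rel i x T.pt
  rel_unique : ∀ {i j x x' y}, T.rel i x y → T.rel j x' y → i = j ∧ x = x'

variable {T : LTS.{u, v, w} P I}

theorem Reaches.nonempty_path {x y : T.carrier} (h : T.Reaches x y) :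
    Nonempty (Quiver.Path x y) := by
  induction h with
  | refl => exact ⟨.nil⟩
  | tail _ hyz ih =>
    obtain ⟨i, hi⟩ := hyz
    exact ih.map (·.cons ⟨i, hi⟩)

theorem reaches_of_path {x y : T.carrier} (π : Quiver.Path x y) : T.Reaches x y := by
  induction π with
  | nil => exact .refl
  | cons _ e ih => exact ih.tail ⟨e.1, e.2⟩

theorem IsTree.path_eq (hT : T.IsTree) {x : T.carrier} (π ρ : Quiver.Path T.pt x) : π = ρ :=
  have := (hT x).some
  Subsingleton.elim π ρ

theorem IsTree.isArborescent (hT : T.IsTree) : T.IsArborescent where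
  reaches x := reaches_of_path (hT x).some.default
  not_rel_pt i x hx := by
    let π := (hT x).some.default
    exact Quiver.Path.cons_ne_nil π ⟨i, hx⟩ (hT.path_eq _ _)
  rel_unique {i j x x' y} hx hx' := by
    have heq := hT.path_eq ((hT x).some.default.cons ⟨i, hx⟩) ((hT x').some.default.cons ⟨j, hx'⟩)
    obtain rfl := Quiver.Path.obj_eq_of_cons_eq_cons heq
    exact ⟨congrArg Subtype.val (eq_of_heq (Quiver.Path.hom_heq_of_cons_eq_cons heq)), rfl⟩

theorem IsArborescent.path_eq (hT : T.IsArborescent) {x : T.carrier}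
    (π ρ : Quiver.Path T.pt x) : π = ρ := by
  induction π with
  | nil =>
    generalize hr : T.pt = r at ρ
    cases ρ with
    | nil => rfl
    | cons _ e =>
      subst hr
      exact absurd e.2 (hT.not_rel_pt _ _)
  | cons π e ih =>
    cases ρ with
    | nil => exact absurd e.2 (hT.not_rel_pt _ _)
    | cons ρ e' =>
      obtain ⟨i, hi⟩ := e
      obtain ⟨j, hj⟩ := e'
      obtain ⟨rfl, rfl⟩ := hT.rel_unique hi hj
      rw [ih ρ]

theorem IsArborescent.isTree (hT : T.IsArborescent) : T.IsTree := fun x =>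
  (hT.reaches x).nonempty_path.map fun π => ⟨⟨π⟩, fun ρ => hT.path_eq ρ π⟩

/-- The system with a single state and no binary facts, in which exactly the letters in `L`
hold. -/
def point (L : Set P) : LTS.{u, v, w} P I where
  carrier := PUnit
  prop p _ := p ∈ L
  rel _ _ _ := False
  pt := ⟨⟩

/-- The disjoint union of `S` and `T` with an `i`-fact added from the distinguished state of `T`,
which stays distinguished, to that of `S`. -/
def graft (i : I) (S T : LTS.{u, v, w} P I) : LTS.{u, v, w} P I where
  carrier := S.carrier ⊕ T.carrier
  prop p := Sum.elim (S.prop p) (T.prop p)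
  rel j
    | .inl x, .inl y => S.rel j x y
    | .inr x, .inr y => T.rel j x y
    | .inr x, .inl y => j = i ∧ x = T.pt ∧ y = S.pt
    | .inl _, .inr _ => False
  pt := .inr T.pt

theorem isArborescent_point (L : Set P) : (point L : LTS.{u, v, w} P I).IsArborescent where
  reaches _ := .refl
  not_rel_pt _ _ := id
  rel_unique := False.elim

theorem isArborescent_graft {S T : LTS.{u, v, w} P I} (hS : S.IsArborescent)
    (hT : T.IsArborescent) (i : I) : (graft i S T).IsArborescent where
  reaches x := by
    have reaches_inr (y : T.carrier) : (graft i S T).Reaches (.inr T.pt) (.inr y) :=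
      Relation.ReflTransGen.lift Sum.inr (fun _ _ h => h) _ _ (hT.reaches y)
    have reaches_inl (y : S.carrier) : (graft i S T).Reaches (.inl S.pt) (.inl y) :=
      Relation.ReflTransGen.lift Sum.inl (fun _ _ h => h) _ _ (hS.reaches y)
    rcases x with x | x
    · have root_rel : (graft i S T).rel i (.inr T.pt) (.inl S.pt) := ⟨rfl, rfl, rfl⟩
      exact .head ⟨i, root_rel⟩ (reaches_inl x)
    · exact reaches_inr x
  not_rel_pt
    | _, .inl _ => id
    | j, .inr x => hT.not_rel_pt j x
  rel_unique {j k x x' y} h h' := by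
    rcases y with y | y <;> rcases x with x | x <;> rcases x' with x' | x'
    · exact (hS.rel_unique h h').imp id (congrArg _)
    · obtain ⟨rfl, rfl, rfl⟩ := h'
      exact absurd h (hS.not_rel_pt _ _)
    · obtain ⟨rfl, rfl, rfl⟩ := h
      exact absurd h' (hS.not_rel_pt _ _)
    · obtain ⟨rfl, rfl, rfl⟩ := h
      obtain ⟨rfl, rfl, -⟩ := h'
      exact ⟨rfl, rfl⟩
    · exact h.elim
    · exact h.elim
    · exact h'.elim
    · exact (hT.rel_unique h h').imp id (congrArg _)

theorem isHom_graft_map {S T : LTS.{u, v, w₁} P I} {S' T' : LTS.{u, v, w₂} P I}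
    {f : S.carrier → S'.carrier} {g : T.carrier → T'.carrier} (hf : S.IsHom S' f)
    (hg : T.IsHom T' g) (i : I) : (graft i S T).IsHom (graft i S' T') (Sum.map f g) where
  map_pt := congrArg Sum.inr hg.map_pt
  map_prop
    | p, .inl x => hf.map_prop p x
    | p, .inr x => hg.map_prop p x
  map_rel
    | j, .inl x, .inl y => hf.map_rel j x y
    | j, .inr x, .inr y => hg.map_rel j x y
    | _, .inr _, .inl _ => fun ⟨hj, hx, hy⟩ =>
      ⟨hj, (congrArg g hx).trans hg.map_pt, (congrArg f hy).trans hf.map_pt⟩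
    | _, .inl _, .inr _ => id

theorem isIso_graft_congr {S T : LTS.{u, v, w₁} P I} {S' T' : LTS.{u, v, w₂} P I} (i : I) :
    S.IsIso S' → T.IsIso T' → (graft i S T).IsIso (graft i S' T')
  | ⟨e, he, he'⟩, ⟨k, hk, hk'⟩ =>
    ⟨e.sumCongr k, isHom_graft_map he hk i, isHom_graft_map he' hk' i⟩

/-- The subsystem of `T` on the set `D`, with distinguished state `r`. -/
def induce (T : LTS.{u, v, w} P I) (D : Set T.carrier) (r : D) : LTS.{u, v, w} P I where
  carrier := D
  prop p x := T.prop p x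
  rel i x y := T.rel i x y
  pt := r

instance (T : LTS.{u, v, w} P I) [Finite T.carrier] (D : Set T.carrier) (r : D) :
    Finite (T.induce D r).carrier :=
  inferInstanceAs (Finite D)

namespace IsArborescent

variable (hT : T.IsArborescent) {i : I} {c : T.carrier} (hc : T.rel i T.pt c)
include hT hc

theorem not_reaches_pt : ¬ T.Reaches c T.pt := fun h => by
  rcases h.cases_tail with h | ⟨x, -, j, hx⟩
  · exact hT.not_rel_pt i T.pt (h ▸ hc)
  · exact hT.not_rel_pt j x hx

theorem eq_of_rel_of_not_reaches {j : I} {x y : T.carrier} (hxy : T.rel j x y)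
    (hx : ¬ T.Reaches c x) (hy : T.Reaches c y) : j = i ∧ x = T.pt ∧ y = c := by
  rcases hy.cases_tail with rfl | ⟨z, hz, k, hzy⟩
  · exact ⟨(hT.rel_unique hxy hc).1, (hT.rel_unique hxy hc).2, rfl⟩
  · exact absurd ((hT.rel_unique hxy hzy).2 ▸ hz) hx

theorem induce_reaches : (T.induce {x | T.Reaches c x} ⟨c, .refl⟩).IsArborescent where
  reaches := by
    rintro ⟨x, hx⟩
    induction hx with
    | refl => exact .refl
    | tail hx hxy ih => exact ih.tail hxy
  not_rel_pt j x hx :=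
    hT.not_reaches_pt hc ((hT.rel_unique hx hc).2 ▸ x.2)
  rel_unique h h' := (hT.rel_unique h h').imp id Subtype.ext

theorem induce_not_reaches :
    (T.induce {x | T.Reaches c x}ᶜ ⟨T.pt, hT.not_reaches_pt hc⟩).IsArborescent where
  reaches := by
    rintro ⟨x, hx⟩
    induction hT.reaches x with
    | refl => exact .refl
    | tail _ hxy ih =>
      exact (ih fun hcx => hx (hcx.tail hxy)).tail hxy
  not_rel_pt j x := hT.not_rel_pt j x.1
  rel_unique h h' := (hT.rel_unique h h').imp id Subtype.ext

theorem isIso_graft_induce : (graft i (T.induce {x | T.Reaches c x} ⟨c, .refl⟩)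
    (T.induce {x | T.Reaches c x}ᶜ ⟨T.pt, hT.not_reaches_pt hc⟩)).IsIso T := by
  classical
  refine isIso_of_iff (Equiv.Set.sumCompl {x | T.Reaches c x}) rfl ?_ ?_
  · rintro p (x | x) <;> rfl
  · rintro j (x | x) (y | y)
    · rfl
    · exact iff_of_false id fun hxy => y.2 (x.2.tail ⟨j, hxy⟩)
    · constructor
      · rintro ⟨rfl, rfl, rfl⟩
        exact hc
      · intro hxy
        obtain ⟨hj, hx, hy⟩ := hT.eq_of_rel_of_not_reaches hc hxy x.2 y.2
        exact ⟨hj, Subtype.ext hx, Subtype.ext hy⟩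
    · rfl

end IsArborescent

end LTS

/-- Terms for finite trees: a single state in which the letters in `L` hold, and a tree `T` whose
root receives an additional `i`-child, at which the tree `S` is planted. -/
inductive TreeTerm (P : Type u) (I : Type v) : Type (max u v)
  | point (L : Set P) : TreeTerm P I
  | graft (i : I) (S T : TreeTerm P I) : TreeTerm P I

namespace TreeTerm

/-- The tree denoted by a term. -/
def toLTS : TreeTerm P I → LTS.{u, v, w} P I
  | point L => LTS.point L
  | graft i S T => LTS.graft i S.toLTS T.toLTS

instance finite_toLTS : (τ : TreeTerm P I) → Finite (τ.toLTS : LTS.{u, v, w} P I).carrier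
  | point _ => inferInstanceAs (Finite PUnit)
  | graft _ S T =>
    have := S.finite_toLTS
    have := T.finite_toLTS
    inferInstanceAs (Finite (S.toLTS.carrier ⊕ T.toLTS.carrier))

theorem isArborescent_toLTS (τ : TreeTerm P I) :
    (τ.toLTS : LTS.{u, v, w} P I).IsArborescent := by
  induction τ with
  | point L => exact LTS.isArborescent_point L
  | graft i S T hS hT => exact LTS.isArborescent_graft hS hT i

theorem isTree_toLTS (τ : TreeTerm P I) : (τ.toLTS : LTS.{u, v, w} P I).IsTree :=
  τ.isArborescent_toLTS.isTree

end TreeTerm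

theorem LTS.IsArborescent.isIso_point {T : LTS.{u, v, w} P I} (hT : T.IsArborescent)
    (h : ∀ i x, ¬ T.rel i T.pt x) : T.IsIso (point {p | T.prop p T.pt} : LTS.{u, v, t} P I) := by
  have eq_pt (x : T.carrier) : x = T.pt := by
    rcases (hT.reaches x).cases_head with hx | ⟨y, ⟨i, hy⟩, -⟩
    · exact hx.symm
    · exact absurd hy (h i y)
  have : Unique T.carrier := ⟨⟨T.pt⟩, eq_pt⟩
  refine isIso_of_iff (Equiv.ofUnique T.carrier PUnit) rfl (fun p x => ?_) fun i x y => ?_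
  · rw [eq_pt x]
    rfl
  · rw [eq_pt x]
    exact iff_of_false (h i y) id

theorem LTS.IsArborescent.exists_isIso_toLTS {T : LTS.{u, v, w} P I} [Finite T.carrier]
    (hT : T.IsArborescent) : ∃ τ : TreeTerm P I, T.IsIso (τ.toLTS : LTS.{u, v, t} P I) := by
  induction hn : Nat.card T.carrier using Nat.strong_induction_on generalizing T with
  | _ n ih =>
    by_cases h : ∀ i x, ¬ T.rel i T.pt x
    · exact ⟨.point _, hT.isIso_point h⟩
    push Not at h
    obtain ⟨i, c, hc⟩ := h
    let D := {x | T.Reaches c x}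
    have hpt : T.pt ∉ D := hT.not_reaches_pt hc
    have hc_mem : c ∉ Dᶜ := not_not_intro .refl
    obtain ⟨σ, hσ⟩ := ih _ (hn ▸ Finite.card_subtype_lt hpt) (hT.induce_reaches hc) rfl
    obtain ⟨τ, hτ⟩ := ih _ (hn ▸ Finite.card_subtype_lt hc_mem) (hT.induce_not_reaches hc) rfl
    exact ⟨.graft i σ τ, (hT.isIso_graft_induce hc).symm.trans (isIso_graft_congr i hσ hτ)⟩

/-! ### Homomorphism counts -/

theorem LTS.card_hom_point (L : Set P) (M : LTS.{u, v, w₂} P I)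
    [Decidable (∀ p ∈ L, M.prop p M.pt)] :
    Nat.card ((point L : LTS.{u, v, w₁} P I).Hom M) = if ∀ p ∈ L, M.prop p M.pt then 1 else 0 := by
  have eq_const (f : (point L : LTS.{u, v, w₁} P I).Hom M) : f.1 = fun _ => M.pt :=
    funext fun _ => f.2.map_pt
  split_ifs with h
  · exact Nat.card_eq_one_iff_unique.2
      ⟨⟨fun f g => Subtype.ext ((eq_const f).trans (eq_const g).symm)⟩,
        ⟨⟨fun _ => M.pt, rfl, fun p _ => h p, fun _ _ _ => False.elim⟩⟩⟩
  · have : IsEmpty ((point L : LTS.{u, v, w₁} P I).Hom M) :=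
      ⟨fun f => h fun p hp => congrFun (eq_const f) ⟨⟩ ▸ f.2.map_prop p ⟨⟩ hp⟩
    exact Nat.card_of_isEmpty

/-- A homomorphism from `graft i S T` consists of a homomorphism from `T` and one from `S` that
sends the root of `S` to a successor of the distinguished state. -/
def LTS.graftHomEquiv (i : I) (S T : LTS.{u, v, w₁} P I) (M : LTS.{u, v, w₂} P I) :
    (graft i S T).Hom M ≃ (Σ y : {y // M.rel i M.pt y}, S.Hom (M.withPt y)) × T.Hom M where
  toFun f :=
    ⟨⟨⟨f.1 (.inl S.pt), by
        have hroot : f.1 (.inr T.pt) = M.pt := f.2.map_pt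
        exact hroot ▸ f.2.map_rel i (.inr T.pt) (.inl S.pt) ⟨rfl, rfl, rfl⟩⟩,
      ⟨f.1 ∘ .inl, rfl, fun p x => f.2.map_prop p (.inl x),
        fun j x y => f.2.map_rel j (.inl x) (.inl y)⟩⟩,
      ⟨f.1 ∘ .inr, f.2.map_pt, fun p x => f.2.map_prop p (.inr x),
        fun j x y => f.2.map_rel j (.inr x) (.inr y)⟩⟩
  invFun g :=
    { val := Sum.elim g.1.2.1 g.2.1
      property.map_pt := g.2.2.map_pt
      property.map_prop
        | p, .inl x => g.1.2.2.map_prop p x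
        | p, .inr x => g.2.2.map_prop p x
      property.map_rel
        | j, .inl x, .inl y => g.1.2.2.map_rel j x y
        | j, .inr x, .inr y => g.2.2.map_rel j x y
        | _, .inl _, .inr _ => False.elim
        | _, .inr _, .inl _ => by
          rintro ⟨rfl, rfl, rfl⟩
          have hS : g.1.2.1 S.pt = g.1.1 := g.1.2.2.map_pt
          have hT : g.2.1 T.pt = M.pt := g.2.2.map_pt
          simpa only [Sum.elim_inl, Sum.elim_inr, hS, hT] using g.1.1.2 }
  left_inv f := Subtype.ext (Sum.elim_comp_inl_inr f.1)
  right_inv _ := Prod.ext (sigma_hom_withPt_ext rfl) rfl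

namespace TreeTerm

section Count

variable (M : LTS.{u, v, w₁} P I) [Fintype M.carrier]

open Classical in
/-- The number of homomorphisms from the tree denoted by a term to `M` that send the root to a
given state, computed by recursion on the term. -/
noncomputable def count : TreeTerm P I → M.carrier → ℕ
  | point L, x => if ∀ p ∈ L, M.prop p x then 1 else 0
  | graft i S T, x => (∑ y : {y // M.rel i x y}, S.count y) * T.count x

theorem card_hom_toLTS (τ : TreeTerm P I) (x : M.carrier) :
    Nat.card ((τ.toLTS : LTS.{u, v, w} P I).Hom (M.withPt x)) = τ.count M x := by
  classical
  induction τ generalizing x with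
  | point L => exact LTS.card_hom_point L (M.withPt x)
  | graft i S T hS hT =>
    rw [toLTS, Nat.card_congr (LTS.graftHomEquiv i _ _ _), Nat.card_prod, Nat.card_sigma, hT, count]
    simp only [hS]

/-- The trees denoted by two terms, with their roots identified. -/
def glue : TreeTerm P I → TreeTerm P I → TreeTerm P I
  | point L, point L' => point (L ∪ L')
  | point L, graft i S T => graft i S (glue (point L) T)
  | graft i S T, τ => graft i S (glue T τ)

theorem count_glue (σ τ : TreeTerm P I) (x : M.carrier) :
    (glue σ τ).count M x = σ.count M x * τ.count M x := by
  classical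
  induction σ with
  | point L =>
    induction τ with
    | point L' =>
      simp only [glue, count, Set.mem_union, or_imp, forall_and, ite_zero_mul_ite_zero, one_mul]
    | graft i S T _ hT => simp only [glue, count, hT, mul_left_comm]
  | graft i S T _ hT => simp only [glue, count, hT, mul_assoc]

theorem prod_map_count (l : List (TreeTerm P I)) (x : M.carrier) :
    (l.map fun τ => τ.count M x).prod = (l.foldr glue (point ∅)).count M x := by
  induction l with
  | nil => simp [count]
  | cons τ l ih => simp only [List.map_cons, List.prod_cons, ih, List.foldr_cons, count_glue]

end Count

end TreeTerm

namespace LTS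

/-- A homomorphism from a disjoint union is a family of homomorphisms on the components, of which
only the one on the distinguished component is told where to send the root. -/
def disjointUnionHomEquiv {J : Type} (F : J → LTS.{u, v, w₁} P I) (j₀ : J)
    (M : LTS.{u, v, w₂} P I) : (disjointUnion F j₀).Hom M ≃
      ∀ j, Σ y : {y // j = j₀ → y = M.pt}, (F j).Hom (M.withPt y) where
  toFun f j :=
    ⟨⟨f.1 ⟨j, (F j).pt⟩, by rintro rfl; exact f.2.map_pt⟩,
      ⟨fun x => f.1 ⟨j, x⟩, rfl, fun p x => f.2.map_prop p ⟨j, x⟩,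
        fun i x y hxy => f.2.map_rel i ⟨j, x⟩ ⟨j, y⟩ ⟨j, x, y, rfl, rfl, hxy⟩⟩⟩
  invFun g :=
    { val x := (g x.1).2.1 x.2
      property.map_pt := (g j₀).2.2.map_pt.trans ((g j₀).1.2 rfl)
      property.map_prop p x := (g x.1).2.2.map_prop p x.2
      property.map_rel := by
        rintro i _ _ ⟨j, x, y, rfl, rfl, hxy⟩
        exact (g j).2.2.map_rel i x y hxy }
  left_inv _ := rfl
  right_inv _ := funext fun _ => sigma_hom_withPt_ext rfl

theorem card_hom_disjointUnion {J : Type} [Fintype J] [DecidableEq J]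
    {F : J → LTS.{u, v, w₁} P I} {τ : J → TreeTerm P I}
    (hF : ∀ j, (F j).IsIso ((τ j).toLTS : LTS.{u, v, t} P I)) (j₀ : J)
    (M : LTS.{u, v, w₂} P I) [Fintype M.carrier] :
    Nat.card ((disjointUnion F j₀).Hom M) =
      (τ j₀).count M M.pt * ∏ j ∈ Finset.univ.erase j₀, ∑ x, (τ j).count M x := by
  classical
  have hcard (j : J) (x : M.carrier) : Nat.card ((F j).Hom (M.withPt x)) = (τ j).count M x :=
    ((hF j).card_hom_eq _).trans ((τ j).card_hom_toLTS M x)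
  have hcomponent (j : J) : Nat.card (Σ y : {y // j = j₀ → y = M.pt}, (F j).Hom (M.withPt y)) =
      ∑ y with (j = j₀ → y = M.pt), (τ j).count M y := by
    have := (hF j).symm.finite
    simp only [Nat.card_sigma, hcard]
    exact (Finset.sum_subtype _ Finset.mem_filter_univ _).symm
  rw [Nat.card_congr (disjointUnionHomEquiv F j₀ M), Nat.card_pi,
    ← Finset.mul_prod_erase _ _ (Finset.mem_univ j₀)]
  simp only [hcomponent]
  congr 1
  · simp [Finset.sum_filter]
  · refine Finset.prod_congr rfl fun j hj => ?_
    simp [Finset.ne_of_mem_erase hj]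

end LTS

section Profiles

variable {M : LTS.{u, v, w₁} P I} {N : LTS.{u, v, w₂} P I}

theorem card_hom_disjointUnion_eq_of_leftProfile_eq
    (h : LTS.leftProfile ℕ (finiteForests.{u, v, t} P I) M =
      LTS.leftProfile ℕ (finiteForests.{u, v, t} P I) N)
    {J : Type} [Finite J] (τ : J → TreeTerm P I) (j₀ : J) :
    Nat.card ((LTS.disjointUnion (fun j => ((τ j).toLTS : LTS.{u, v, t} P I)) j₀).Hom M) =
      Nat.card ((LTS.disjointUnion (fun j => ((τ j).toLTS : LTS.{u, v, t} P I)) j₀).Hom N) := by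
  have hmem : LTS.disjointUnion (fun j => ((τ j).toLTS : LTS.{u, v, t} P I)) j₀ ∈
      finiteForests P I :=
    ⟨inferInstanceAs (Finite (Σ j, (τ j).toLTS.carrier)), J, inferInstance, _, j₀,
      fun j => (τ j).isTree_toLTS, .refl _⟩
  exact congrFun h ⟨_, hmem⟩

variable [Fintype M.carrier] [Fintype N.carrier]

theorem leftProfile_finiteForests_eq_iff :
    LTS.leftProfile ℕ (finiteForests.{u, v, t} P I) M =
        LTS.leftProfile ℕ (finiteForests.{u, v, t} P I) N ↔
      (∀ τ : TreeTerm P I, τ.count M M.pt = τ.count N N.pt) ∧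
        ∀ τ : TreeTerm P I, ∑ x, τ.count M x = ∑ y, τ.count N y := by
  classical
  constructor
  · intro h
    have hroot (τ : TreeTerm P I) : τ.count M M.pt = τ.count N N.pt := by
      have hcard := card_hom_disjointUnion_eq_of_leftProfile_eq h (fun _ : Unit => τ) ()
      simpa [LTS.card_hom_disjointUnion (fun _ => .refl _)] using hcard
    refine ⟨hroot, fun τ => ?_⟩
    have hcard := card_hom_disjointUnion_eq_of_leftProfile_eq h (fun b => cond b (.point ∅) τ) true
    have herase : (Finset.univ : Finset Bool).erase true = {false} := rfl
    simpa [LTS.card_hom_disjointUnion (fun _ => .refl _), herase, TreeTerm.count] using hcard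
  · rintro ⟨hroot, hsum⟩
    funext ⟨T, hfinite, hT⟩
    obtain ⟨J, hJ, F, j₀, hF, hiso⟩ := hT
    have hcomponent (j : J) : ∃ τ : TreeTerm P I, (F j).IsIso (τ.toLTS : LTS.{u, v, t} P I) := by
      have : Finite (Σ j, (F j).carrier) := hiso.finite
      have : Finite (F j).carrier :=
        .of_injective _ (sigma_mk_injective (β := fun j => (F j).carrier) (i := j))
      exact (hF j).isArborescent.exists_isIso_toLTS
    choose τ hτ using hcomponent
    have := Fintype.ofFinite J
    simp only [LTS.leftProfile, LTS.homCount, hiso.card_hom_eq, LTS.card_hom_disjointUnion hτ,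
      hroot, hsum]

theorem IsCountingBisimulation.count_eq {Z : M.carrier → N.carrier → Prop}
    (hZ : IsCountingBisimulation M N Z) (τ : TreeTerm P I) {x : M.carrier} {y : N.carrier}
    (hxy : Z x y) : τ.count M x = τ.count N y := by
  classical
  induction τ generalizing x y with
  | point L => simp only [TreeTerm.count, hZ.prop_iff hxy]
  | graft i S T hS hT =>
    obtain ⟨e, he⟩ := hZ.exists_equiv_succ hxy i
    rw [TreeTerm.count, TreeTerm.count, hT hxy]
    exact congrArg (· * _) (Fintype.sum_equiv e _ _ fun x' => hS (he x'))

theorem exists_equiv_count_eq {A B : Type*} [Fintype A] [Fintype B] {a : A → M.carrier}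
    {b : B → N.carrier} (h : ∀ τ : TreeTerm P I, ∑ k, τ.count M (a k) = ∑ k, τ.count N (b k)) :
    ∃ e : A ≃ B, ∀ k (τ : TreeTerm P I), τ.count M (a k) = τ.count N (b (e k)) := by
  obtain ⟨e, he⟩ := exists_equiv_of_sum_list_prod_eq_nat
    (f := fun k (τ : TreeTerm P I) => τ.count M (a k))
    (g := fun k τ => τ.count N (b k)) fun l => by simpa only [TreeTerm.prod_map_count] using h _
  exact ⟨e, fun k τ => (congrFun (he k) τ).symm⟩

theorem isCountingBisimulation_count_eq
    (h : ∀ τ : TreeTerm P I, ∑ x, τ.count M x = ∑ y, τ.count N y) :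
    IsCountingBisimulation M N fun x y => ∀ τ : TreeTerm P I, τ.count M x = τ.count N y where
  prop_iff hxy p := by
    simpa only [TreeTerm.count, Set.mem_singleton_iff, forall_eq, ite_one_zero_inj]
      using hxy (.point {p})
  exists_equiv_succ hxy i := by
    classical
    refine exists_equiv_count_eq fun τ => ?_
    simpa [TreeTerm.count] using hxy (.graft i τ (.point ∅))
  exists_equiv := exists_equiv_count_eq h

end Profiles

theorem countingBisimilar_iff_leftProfile_eq {M : LTS.{u, v, w₁} P I}
    {N : LTS.{u, v, w₂} P I} [Finite M.carrier] [Finite N.carrier] : CountingBisimilar M N ↔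
    LTS.leftProfile ℕ (finiteForests.{u, v, t} P I) M =
      LTS.leftProfile ℕ (finiteForests.{u, v, t} P I) N := by
  have := Fintype.ofFinite M.carrier
  have := Fintype.ofFinite N.carrier
  rw [leftProfile_finiteForests_eq_iff]
  constructor
  · rintro ⟨Z, hZ, hpt⟩
    obtain ⟨e, he⟩ := hZ.exists_equiv
    exact ⟨fun τ => hZ.count_eq τ hpt,
      fun τ => Fintype.sum_equiv e _ _ fun x => hZ.count_eq τ (he x)⟩
  · rintro ⟨hroot, hsum⟩
    exact ⟨_, isCountingBisimulation_count_eq hsum, hroot⟩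

end ModalHom

theorem mainTheorem6_general {P : Type u} {I : Type v}
    (M : ModalHom.LTS.{u, v, w₁} P I) (N : ModalHom.LTS.{u, v, w₂} P I)
    [Finite M.carrier] [Finite N.carrier] :
    ModalHom.Equivalent M N ↔
      ModalHom.LTS.leftProfile ℕ (ModalHom.finiteForests.{u, v, t} P I) M =
        ModalHom.LTS.leftProfile ℕ (ModalHom.finiteForests.{u, v, t} P I) N := by
  rw [ModalHom.equivalent_iff_countingBisimilar, ModalHom.countingBisimilar_iff_leftProfile_eq]

theorem mainTheorem6 {P : Type u} {I : Type v} [Finite P] [Finite I]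
    (M : ModalHom.LTS.{u, v, w₁} P I) (N : ModalHom.LTS.{u, v, w₂} P I)
    [Finite M.carrier] [Finite N.carrier] :
    ModalHom.Equivalent M N ↔
      ModalHom.LTS.leftProfile ℕ (ModalHom.finiteForests.{u, v, t} P I) M =
        ModalHom.LTS.leftProfile ℕ (ModalHom.finiteForests.{u, v, t} P I) N :=
  mainTheorem6_general M N
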